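/- Let $d\in\mathbb{N}=\{1,2,\dots\}$. Let $\mathcal{G}_d$ be the set of functions $f=e^{\phi}\colon\mathbb{R}^d\to[0,\infty)$ with $\phi\colon\mathbb{R}^d\to[-\infty,\infty)$ upper semi-continuous and concave (and $e^{-\infty}=0$), and let $\operatorname{supp} f=\{x: f(x)\neq 0\}$. For $k\in\mathbb{N}$, say that $f\in\mathcal{G}_d$ is log-$k$-affine if there are closed sets $F_1,\dots,F_k\subseteq\mathbb{R}^d$ with $\operatorname{supp} f=\bigcup_{j=1}^k F_j$ such that $\log f$ agrees with an affine function on each $F_j$. A polyhedral set is an intersection of finitely many closed half-spaces of $\mathbb{R}^d$ ($\mathbb{R}^d$ itself included). Let $\mathcal{P}$ be the collection of polyhedral sets in $\mathbb{R}^d$ with non-empty interior. A facet of a convex set $E$ is a non-empty set of the form $E\cap H$ of affine dimension $\dim(E)-1$, where the affine hyperplane $H$ is the boundary of a closed half-space containing $E$. For an integer $m\ge 0$, let $\mathcal{P}^m$ be the collection of all $P\in\mathcal{P}$ with at most $m$ facets. A face of a convex set $E$ is a (possibly empty) convex set $F\subseteq E$ such that $u,v\in F$ whenever $u,v\in E$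 and $tu+(1-t)v\in F$ for some $t\in(0,1)$. A polyhedral subdivision of $P\in\mathcal{P}$ is a finite collection of distinct sets $E_1,\dots,E_\ell\in\mathcal{P}$ with $P=\bigcup_{j=1}^{\ell}E_j$ such that $E_i\cap E_j$ is a common face of $E_i$ and $E_j$ for all $i,j$. Suppose that $f\in\mathcal{G}_d$ is log-$k$-affine for some $k\in\mathbb{N}$ and that $\operatorname{supp} f\in\mathcal{P}$. Then there exist an integer $\kappa(f)\le k$, vectors $\alpha_1,\dots,\alpha_{\kappa(f)}\in\mathbb{R}^d$, reals $\beta_1,\dots,\beta_{\kappa(f)}$ and a polyhedral subdivision $E_1,\dots,E_{\kappa(f)}$ of $\operatorname{supp} f$ such that $f(x)=\exp(\alpha_j^{\top}x+\beta_j)$ for all $x\in E_j$ and all $j$, and $\alpha_i\ne\alpha_j$ whenever $i\ne j$. Moreover, the triples $(\alpha_j,\beta_j,E_j)_{j=1}^{\kappa(f)}$ are unique up to reordering: if $(\alpha_j',\beta_j',E_j')_{j=1}^{\kappa'}$, for any integer $\kappa'\ge 0$, are triples with $(E_j')_{j=1}^{\kappa'}$ a polyhedral subdivision of $\operatorname{supp}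 f$, $f(x)=\exp(\alpha_j'^{\top}x+\beta_j')$ for all $x\in E_j'$, and the $\alpha_j'$ pairwise distinct, then $\kappa'=\kappa(f)$ and the two families of triples agree up to a permutation of the indices. In addition, for every integer $m\ge 0$, if $\operatorname{supp} f\in\mathcal{P}^m$, then $E_j\in\mathcal{P}^{k+m-1}$ for all $j$. -/

import Mathlib

/-- The Euclidean space `ℝ^d`. -/
abbrev Rd (d : ℕ) : Type := EuclideanSpace ℝ (Fin d)

/-- `φ : ℝ^d → [-∞, ∞)` is concave and upper semi-continuous. Values in `[-∞, ∞)` are extended reals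
other than `⊤`; for weights in `(0, 1)` the products and sums below follow the usual conventions
(`t · (-∞) = -∞` and `-∞ + c = -∞`). -/
structure IsConcaveUSC {d : ℕ} (φ : Rd d → EReal) : Prop where
  ne_top : ∀ x, φ x ≠ ⊤
  upperSemicontinuous : UpperSemicontinuous φ
  concave : ∀ (x y : Rd d) (t : ℝ), 0 < t → t < 1 →
    (t : EReal) * φ x + ((1 - t : ℝ) : EReal) * φ y ≤ φ (t • x + (1 - t) • y)

/-- The class `𝒢_d` of functions `f = e^φ : ℝ^d → ℝ` with `φ : ℝ^d → [-∞, ∞)` concave and upper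
semi-continuous, where `e^{-∞} = 0`. -/
def LogConcaveUSC (d : ℕ) : Set (Rd d → ℝ) :=
  {f | ∃ φ : Rd d → EReal, IsConcaveUSC φ ∧ ∀ x, f x = (EReal.exp (φ x)).toReal}

/-- `f` is log-`k`-affine: its support is a union of `k` closed sets on each of which `log f`
coincides with an affine function. The closed sets need not be convex. -/
def IsLogAffine {d : ℕ} (k : ℕ) (f : Rd d → ℝ) : Prop :=
  ∃ E : Fin k → Set (Rd d), (∀ j, IsClosed (E j)) ∧ Function.support f = ⋃ j, E j ∧
    ∀ j, ∃ (θ : Rd d) (ζ : ℝ), ∀ x ∈ E j, Real.log (f x) = inner ℝ θ x + ζ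

/-- The set `{x : ⟪a, x⟫ ≤ u}`, a closed half-space when `a ≠ 0`. -/
def closedHalfSpace {d : ℕ} (a : Rd d) (u : ℝ) : Set (Rd d) := {x | inner ℝ a x ≤ u}

/-- The set `{x : ⟪a, x⟫ = u}`, an affine hyperplane (the boundary of `closedHalfSpace a u`)
when `a ≠ 0`. -/
def affineHyperplane {d : ℕ} (a : Rd d) (u : ℝ) : Set (Rd d) := {x | inner ℝ a x = u}

/-- An intersection of finitely many closed half-spaces; the empty intersection is `ℝ^d`. -/
def IsPolyhedralSet {d : ℕ} (P : Set (Rd d)) : Prop :=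
  ∃ (n : ℕ) (a : Fin n → Rd d) (u : Fin n → ℝ),
    (∀ i, a i ≠ 0) ∧ P = ⋂ i, closedHalfSpace (a i) (u i)

/-- The class `𝒫_d` of polyhedral sets in `ℝ^d` with non-empty interior. -/
def Polyhedra (d : ℕ) : Set (Set (Rd d)) := {P | IsPolyhedralSet P ∧ (interior P).Nonempty}

/-- The dimension of the affine hull of `A` (used only for non-empty `A`). -/
noncomputable def affineDim {d : ℕ} (A : Set (Rd d)) : ℕ := Module.finrank ℝ (vectorSpan ℝ A)

/-- `F = E ∩ H` for an affine hyperplane `H` that supports `E`. -/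
def IsExposedFace {d : ℕ} (E F : Set (Rd d)) : Prop :=
  ∃ (a : Rd d) (u : ℝ), a ≠ 0 ∧ E ⊆ closedHalfSpace a u ∧ (E ∩ affineHyperplane a u).Nonempty ∧
    F = E ∩ affineHyperplane a u

/-- The facets of `E`: its exposed faces of affine dimension `dim E - 1`. -/
def facets {d : ℕ} (E : Set (Rd d)) : Set (Set (Rd d)) :=
  {F | IsExposedFace E F ∧ affineDim F + 1 = affineDim E}

/-- The class `𝒫_d^m` of sets in `𝒫_d` with at most `m` facets. -/
def PolyhedraWithFacets (d m : ℕ) : Set (Set (Rd d)) :=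
  {P | P ∈ Polyhedra d ∧ (facets P).encard ≤ m}

/-- `F` is a face of `E`: a convex subset of `E` such that `x, y ∈ F` whenever `x, y ∈ E` and a point
of the open segment between `x` and `y` is in `F`. The empty set is a face. -/
def IsFace {d : ℕ} (E F : Set (Rd d)) : Prop := Convex ℝ F ∧ IsExtreme ℝ E F

/-- The distinct sets `E_1, …, E_ℓ ∈ 𝒫_d` form a polyhedral subdivision of `P`. -/
structure IsPolyhedralSubdivision {d ℓ : ℕ} (P : Set (Rd d)) (E : Fin ℓ → Set (Rd d)) : Prop where
  mem : ∀ j, E j ∈ Polyhedra d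
  injective : Function.Injective E
  iUnion_eq : P = ⋃ j, E j
  common_face : ∀ i j, IsFace (E i) (E i ∩ E j) ∧ IsFace (E j) (E i ∩ E j)

/-- The triples `(α_j, β_j, E_j)`, `j = 1, …, κ`, represent `f`: the sets `E_j` form a polyhedral
subdivision of the support of `f`, the vectors `α_j` are pairwise distinct and
`f(x) = exp(⟪α_j, x⟫ + β_j)` on `E_j`. -/
structure IsLogAffineRepresentation {d κ : ℕ} (f : Rd d → ℝ)
    (α : Fin κ → Rd d) (β : Fin κ → ℝ) (E : Fin κ → Set (Rd d)) : Prop where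
  subdivision : IsPolyhedralSubdivision (Function.support f) E
  eq_exp : ∀ j, ∀ x ∈ E j, f x = Real.exp (inner ℝ (α j) x + β j)
  distinct : ∀ i j, i ≠ j → α i ≠ α j

/-!
On its support `P`, the function `g = log f` is concave and agrees with finitely many affine
functions `ℓ_j` on closed sets `F_j` covering `P`. By Baire's theorem only those `F_j` with non-empty
interior are needed to cover `P`, since `P` is the closure of its interior. If `F_j` has an interior
point, then `g - ℓ_j` has a local maximum there, so concavity gives `g ≤ ℓ_j` on all of `P`
(`ConcaveOn.le_affine_of_eqOn`). Hence `g` is on `P` the minimum of these `ℓ_j`, and the cells of the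
subdivision are the sets `E_j = {x ∈ P | ℓ_j x ≤ ℓ_i x for all i}`, one for each distinct `ℓ_j`.
Two of these affine functions with the same slope coincide, because `g` lies below both and touches
both. The set `E_i ∩ E_j` is the part of `E_i` where `ℓ_i - ℓ_j ≤ 0` attains its maximum `0`, so it
is a face.

For uniqueness, the interior of a cell of one representation can only meet interiors of cells of the
other one that carry the same affine function, and by Baire's theorem each open part of it meets
some (`IsLogAffineRepresentation.exists_eq`). So the same affine functions occur in both, and cells
carrying the same function are contained in each other (`IsLogAffineRepresentation.subset_of_eq`).

For the number of facets, a facet of an intersection of half-spaces lies in the boundary hyperplane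
of one of them (`exists_subset_affineHyperplane_of_mem_facets`) and, by dimension, is cut out by it
(`eq_inter_affineHyperplane_of_mem_facets`). If that half-space is one of those defining `P`, then the
hyperplane also cuts out a facet of `P`. So each half-space intersected with `P` adds at most one
facet (`encard_facets_inter_le`), and `E_j` arises from `P` by at most `k - 1` half-spaces.
-/

/-! ### Closed half-spaces and polyhedral sets -/

lemma isClosed_closedHalfSpace {d : ℕ} (a : Rd d) (u : ℝ) : IsClosed (closedHalfSpace a u) :=
  isClosed_le (by fun_prop) continuous_const

lemma convex_closedHalfSpace {d : ℕ} (a : Rd d) (u : ℝ) : Convex ℝ (closedHalfSpace a u) :=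
  convex_halfSpace_le (innerₛₗ ℝ a).isLinear u

lemma convex_affineHyperplane {d : ℕ} (a : Rd d) (u : ℝ) : Convex ℝ (affineHyperplane a u) :=
  convex_hyperplane (innerₛₗ ℝ a).isLinear u

lemma IsPolyhedralSet.of_finite {d : ℕ} {ι : Type*} [Finite ι] (a : ι → Rd d) (u : ι → ℝ)
    (ha : ∀ i, a i ≠ 0) : IsPolyhedralSet (⋂ i, closedHalfSpace (a i) (u i)) := by
  obtain ⟨n, ⟨e⟩⟩ := Finite.exists_equiv_fin ι
  refine ⟨n, a ∘ e.symm, u ∘ e.symm, fun i => ha _, ?_⟩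
  exact (e.symm.surjective.iInter_comp fun i => closedHalfSpace (a i) (u i)).symm

lemma IsPolyhedralSet.isClosed {d : ℕ} {P : Set (Rd d)} (hP : IsPolyhedralSet P) : IsClosed P := by
  obtain ⟨n, a, u, -, rfl⟩ := hP
  exact isClosed_iInter fun i => isClosed_closedHalfSpace _ _

lemma IsPolyhedralSet.convex {d : ℕ} {P : Set (Rd d)} (hP : IsPolyhedralSet P) : Convex ℝ P := by
  obtain ⟨n, a, u, -, rfl⟩ := hP
  exact convex_iInter fun i => convex_closedHalfSpace _ _

lemma inter_iInter_closedHalfSpace_eq {d : ℕ} {ι κ : Type*} (a : ι → Rd d) (u : ι → ℝ)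
    (b : κ → Rd d) (v : κ → ℝ) :
    (⋂ i, closedHalfSpace (a i) (u i)) ∩ (⋂ i, closedHalfSpace (b i) (v i)) =
      ⋂ i : ι ⊕ κ, closedHalfSpace (Sum.elim a b i) (Sum.elim u v i) := by
  ext x; simp

lemma IsPolyhedralSet.inter_iInter {d : ℕ} {P : Set (Rd d)} (hP : IsPolyhedralSet P) {κ : Type*}
    [Finite κ] (b : κ → Rd d) (v : κ → ℝ) (hb : ∀ i, b i ≠ 0) :
    IsPolyhedralSet (P ∩ ⋂ i, closedHalfSpace (b i) (v i)) := by
  obtain ⟨n, a, u, ha, rfl⟩ := hP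
  rw [inter_iInter_closedHalfSpace_eq]
  exact .of_finite _ _ (by rintro (i | i) <;> simp [ha, hb])

lemma subset_of_interior_subset {d : ℕ} {P C : Set (Rd d)} (hP : P ∈ Polyhedra d)
    (hC : IsClosed C) (h : interior P ⊆ C) : P ⊆ C := by
  have h1 := hP.1.convex.closure_interior_eq_closure_of_nonempty_interior hP.2
  rw [hP.1.isClosed.closure_eq] at h1
  rw [← h1]
  exact closure_minimal h hC

/-- The points of `E` on a hyperplane bounding a half-space that contains `E` form a face of `E`. -/
lemma isFace_inter_affineHyperplane {d : ℕ} {E : Set (Rd d)} (hE : Convex ℝ E) {a : Rd d} {u : ℝ}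
    (h : E ⊆ closedHalfSpace a u) : IsFace E (E ∩ affineHyperplane a u) := by
  refine ⟨hE.inter (convex_affineHyperplane a u), ⟨Set.inter_subset_left, ?_⟩⟩
  rintro x hx y hy z ⟨-, hz⟩ ⟨s, t, hs, ht, hst, rfl⟩
  refine ⟨hx, ?_⟩
  have h1 : inner ℝ a x ≤ u := h hx
  have h2 : inner ℝ a y ≤ u := h hy
  have h3 : inner ℝ a (s • x + t • y) = u := hz
  rw [inner_add_right, inner_smul_right, inner_smul_right] at h3
  change inner ℝ a x = u
  have h4 : t = 1 - s := by linarith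
  subst h4
  nlinarith

/-! ### Facets -/

lemma affineDim_eq_of_interior_nonempty {d : ℕ} {E : Set (Rd d)} (hE : (interior E).Nonempty) :
    affineDim E = d := by
  have h : affineSpan ℝ E = ⊤ :=
    affineSpan_eq_top_of_nonempty_interior
      (hE.mono (interior_mono (subset_convexHull ℝ E)))
  rw [affineDim, ← direction_affineSpan, h, AffineSubspace.direction_top, finrank_top,
    finrank_euclideanSpace_fin]

lemma vectorSpan_le_orthogonal {d : ℕ} {F : Set (Rd d)} {a : Rd d} {u : ℝ}
    (h : F ⊆ affineHyperplane a u) : vectorSpan ℝ F ≤ (ℝ ∙ a)ᗮ := by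
  rw [vectorSpan_def, Submodule.span_le]
  rintro _ ⟨x, hx, y, hy, rfl⟩
  have h1 : inner ℝ a x = u := h hx
  have h2 : inner ℝ a y = u := h hy
  simp only [SetLike.mem_coe, Submodule.mem_orthogonal_singleton_iff_inner_right, vsub_eq_sub,
    inner_sub_right, h1, h2, sub_self]

lemma finrank_orthogonal_add_one {d : ℕ} {a : Rd d} (ha : a ≠ 0) :
    Module.finrank ℝ (ℝ ∙ a)ᗮ + 1 = d := by
  have h := Submodule.finrank_add_finrank_orthogonal (ℝ ∙ a)
  rw [finrank_span_singleton ha, finrank_euclideanSpace_fin] at h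
  omega

/-- A hyperplane that contains a facet of a full-dimensional set cuts out that facet: the facet spans
both this hyperplane and the supporting one. -/
lemma eq_inter_affineHyperplane_of_mem_facets {d : ℕ} {E F : Set (Rd d)}
    (hE : (interior E).Nonempty) (hF : F ∈ facets E) {b : Rd d} {v : ℝ} (hb : b ≠ 0)
    (h : F ⊆ affineHyperplane b v) : F = E ∩ affineHyperplane b v := by
  obtain ⟨⟨a, u, ha, -, ⟨x₀, hx₀⟩, hFa⟩, hdim⟩ := hF
  rw [affineDim_eq_of_interior_nonempty hE, affineDim] at hdim
  have hx₀F : x₀ ∈ F := hFa ▸ hx₀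
  have e1 : vectorSpan ℝ F = (ℝ ∙ a)ᗮ :=
    Submodule.eq_of_le_of_finrank_eq
      (vectorSpan_le_orthogonal (u := u) (hFa.subset.trans Set.inter_subset_right))
      (by have := finrank_orthogonal_add_one ha; omega)
  have e2 : vectorSpan ℝ F = (ℝ ∙ b)ᗮ :=
    Submodule.eq_of_le_of_finrank_eq (vectorSpan_le_orthogonal h)
      (by have := finrank_orthogonal_add_one hb; omega)
  refine Set.Subset.antisymm
    (fun x hx => ⟨(hFa.subset hx).1, h hx⟩) fun x hx => ?_
  rw [hFa]
  refine ⟨hx.1, ?_⟩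
  have h1 : inner ℝ b x = v := hx.2
  have h2 : inner ℝ b x₀ = v := h hx₀F
  have h3 : inner ℝ a x₀ = u := hx₀.2
  have h4 : x - x₀ ∈ (ℝ ∙ b)ᗮ := by
    rw [Submodule.mem_orthogonal_singleton_iff_inner_right, inner_sub_right, h1, h2, sub_self]
  rw [← e2, e1, Submodule.mem_orthogonal_singleton_iff_inner_right, inner_sub_right] at h4
  change inner ℝ a x = u
  linarith

lemma notMem_interior_of_mem_affineHyperplane {d : ℕ} {E : Set (Rd d)} {a y : Rd d} {u : ℝ}
    (ha : a ≠ 0) (hE : E ⊆ closedHalfSpace a u) (hy : y ∈ affineHyperplane a u) :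
    y ∉ interior E := by
  intro hyE
  have hc : Filter.Tendsto (fun t : ℝ => y + t • a) (nhds 0) (nhds y) := by
    have : Continuous fun t : ℝ => y + t • a := by fun_prop
    simpa using this.tendsto 0
  have hev := (hc.eventually (mem_interior_iff_mem_nhds.1 hyE)).filter_mono
    (nhdsWithin_le_nhds (s := Set.Ioi 0))
  obtain ⟨t, ht, ht0⟩ := (hev.and self_mem_nhdsWithin).exists
  have h1 : inner ℝ a (y + t • a) ≤ u := hE ht
  have h2 : inner ℝ a y = u := hy
  rw [inner_add_right, inner_smul_right, h2] at h1
  have h3 : 0 < inner ℝ a a := real_inner_self_pos.2 ha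
  have h4 : 0 < t * inner ℝ a a := mul_pos ht0 h3
  linarith

/-- If a facet had, for each defining half-space, a point off its boundary hyperplane, then by
convexity it would have a point off all of them, which would be an interior point. -/
lemma exists_subset_affineHyperplane_of_mem_facets {d : ℕ} {ι : Type*} [Finite ι] {a : ι → Rd d}
    {u : ι → ℝ} {F : Set (Rd d)} (hF : F ∈ facets (⋂ i, closedHalfSpace (a i) (u i))) :
    ∃ i, F ⊆ affineHyperplane (a i) (u i) := by
  classical
  cases nonempty_fintype ι
  obtain ⟨⟨c, w, hc, hEc, hne, hFe⟩, -⟩ := hF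
  by_contra! hcon
  have hFE : ∀ x ∈ F, ∀ i, inner ℝ (a i) x ≤ u i := fun x hx i =>
    Set.mem_iInter.1 (hFe.subset hx).1 i
  have hconv : Convex ℝ F := by
    rw [hFe]
    exact (convex_iInter fun i => convex_closedHalfSpace _ _).inter (convex_affineHyperplane _ _)
  have key : ∀ s : Finset ι, ∃ y ∈ F, ∀ i ∈ s, inner ℝ (a i) y < u i := by
    intro s
    induction s using Finset.induction_on with
    | empty =>
      rw [← hFe] at hne
      exact ⟨hne.some, hne.some_mem, by simp⟩
    | insert j s hj ih =>
      obtain ⟨y, hy, hys⟩ := ih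
      obtain ⟨x, hx, hxj⟩ := Set.not_subset.1 (hcon j)
      have hxj' : inner ℝ (a j) x < u j := lt_of_le_of_ne (hFE x hx j) hxj
      refine ⟨(1 / 2 : ℝ) • x + (1 / 2 : ℝ) • y,
        hconv hx hy (by norm_num) (by norm_num) (by norm_num), fun i hi => ?_⟩
      rw [inner_add_right, inner_smul_right, inner_smul_right]
      have h1 := hFE x hx i
      have h2 := hFE y hy i
      rcases Finset.mem_insert.1 hi with rfl | hi
      · linarith
      · linarith [hys i hi]
  obtain ⟨y, hy, hlt⟩ := key Finset.univ
  refine notMem_interior_of_mem_affineHyperplane hc hEc (hFe.subset hy).2 ?_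
  have hopen : IsOpen (⋂ i, {x : Rd d | inner ℝ (a i) x < u i}) :=
    isOpen_iInter_of_finite fun i => isOpen_lt (by fun_prop) continuous_const
  exact interior_maximal (Set.iInter_mono fun i x (hx : inner ℝ (a i) x < u i) => hx.le) hopen
    (Set.mem_iInter.2 fun i => hlt i (Finset.mem_univ i))

/-- If a supporting hyperplane of `P` cuts out a facet of a full-dimensional subset `E`, then it cuts
out a facet of `P`. -/
lemma inter_affineHyperplane_mem_facets {d : ℕ} {P E : Set (Rd d)} (hEP : E ⊆ P)
    (hE : (interior E).Nonempty) {a : Rd d} {u : ℝ} (ha : a ≠ 0) (hP : P ⊆ closedHalfSpace a u)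
    (hF : E ∩ affineHyperplane a u ∈ facets E) : P ∩ affineHyperplane a u ∈ facets P := by
  have hsub : E ∩ affineHyperplane a u ⊆ P ∩ affineHyperplane a u :=
    Set.inter_subset_inter_left _ hEP
  obtain ⟨⟨_, _, -, -, hne, hFe⟩, hdim⟩ := hF
  refine ⟨⟨a, u, ha, hP, ?_, rfl⟩, ?_⟩
  · rw [← hFe] at hne
    exact hne.mono hsub
  · rw [affineDim_eq_of_interior_nonempty hE] at hdim
    rw [affineDim_eq_of_interior_nonempty (hE.mono (interior_mono hEP))]
    have h1 := Submodule.finrank_mono (vectorSpan_mono ℝ hsub)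
    have h2 := Submodule.finrank_mono
      (vectorSpan_le_orthogonal (Set.inter_subset_right : P ∩ affineHyperplane a u ⊆ _))
    have h3 := finrank_orthogonal_add_one ha
    unfold affineDim at *
    omega

lemma encard_facets_inter_le {d : ℕ} {P : Set (Rd d)} (hP : IsPolyhedralSet P) {κ : Type*}
    [Fintype κ] (b : κ → Rd d) (v : κ → ℝ) (hb : ∀ i, b i ≠ 0)
    (hE : (interior (P ∩ ⋂ i, closedHalfSpace (b i) (v i))).Nonempty) :
    (facets (P ∩ ⋂ i, closedHalfSpace (b i) (v i))).encard ≤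
      (facets P).encard + Fintype.card κ := by
  obtain ⟨n, a, u, ha, hPe⟩ := hP
  set E := P ∩ ⋂ i, closedHalfSpace (b i) (v i) with hEdef
  have hEe : E = ⋂ i : Fin n ⊕ κ, closedHalfSpace (Sum.elim a b i) (Sum.elim u v i) := by
    rw [hEdef, hPe, inter_iInter_closedHalfSpace_eq]
  have hsub : facets E ⊆ ((fun F => E ∩ F) '' facets P) ∪
      Set.range (fun i => E ∩ affineHyperplane (b i) (v i)) := by
    intro F hF
    obtain ⟨i | i, hi⟩ := exists_subset_affineHyperplane_of_mem_facets (hEe ▸ hF)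
    · have h1 := eq_inter_affineHyperplane_of_mem_facets hE hF (ha i) hi
      refine Or.inl ⟨P ∩ affineHyperplane (a i) (u i), ?_, ?_⟩
      · refine inter_affineHyperplane_mem_facets Set.inter_subset_left hE (ha i) ?_ (h1 ▸ hF)
        exact hPe.subset.trans (Set.iInter_subset _ i)
      · change E ∩ (P ∩ affineHyperplane (a i) (u i)) = F
        rw [h1, ← Set.inter_assoc, Set.inter_eq_left.2 (Set.inter_subset_left : E ⊆ P)]
        rfl
    · exact Or.inr ⟨i, (eq_inter_affineHyperplane_of_mem_facets hE hF (hb i) hi).symm⟩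
  refine (Set.encard_le_encard hsub).trans ((Set.encard_union_le _ _).trans ?_)
  refine add_le_add (Set.encard_image_le _ _) ?_
  rw [← Set.image_univ]
  refine (Set.encard_image_le _ _).trans ?_
  simp

/-! ### Affine functions on sets with non-empty interior -/

/-- The instance of Baire's theorem used throughout: if finitely many closed sets cover a non-empty
open set, then one of them has an interior point there. -/
lemma exists_inter_interior_nonempty {X ι : Type*} [TopologicalSpace X] [BaireSpace X] [Finite ι]
    {F : ι → Set X} (hF : ∀ i, IsClosed (F i)) {U : Set X} (hU : IsOpen U) (hne : U.Nonempty)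
    (hsub : U ⊆ ⋃ i, F i) : ∃ i, (U ∩ interior (F i)).Nonempty := by
  have hd : Dense (⋃ o : Option ι, interior (o.elim Uᶜ F)) := by
    refine dense_iUnion_interior_of_closed ?_ ?_
    · rintro (_ | i)
      exacts [hU.isClosed_compl, hF i]
    · refine Set.eq_univ_of_forall fun x => ?_
      by_cases hx : x ∈ U
      · obtain ⟨i, hi⟩ := Set.mem_iUnion.1 (hsub hx)
        exact Set.mem_iUnion.2 ⟨some i, hi⟩
      · exact Set.mem_iUnion.2 ⟨none, hx⟩
  obtain ⟨x, hxU, hx⟩ := hd.inter_open_nonempty U hU hne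
  obtain ⟨_ | i, hi⟩ := Set.mem_iUnion.1 hx
  · exact absurd hxU (interior_subset hi)
  · exact ⟨i, x, hxU, hi⟩

lemma eq_of_affine_eqOn {d : ℕ} {U : Set (Rd d)} (hU : IsOpen U) (hne : U.Nonempty)
    {a b : Rd d} {u v : ℝ} (h : ∀ x ∈ U, inner ℝ a x + u = inner ℝ b x + v) : a = b ∧ u = v := by
  obtain ⟨x, hx⟩ := hne
  have hab : a = b := by
    by_contra hab
    refine notMem_interior_of_mem_affineHyperplane (E := U) (a := a - b) (u := v - u) (y := x)
      (sub_ne_zero.2 hab) (fun y hy => ?_) ?_ (hU.interior_eq.symm ▸ hx)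
    · change inner ℝ (a - b) y ≤ v - u
      rw [inner_sub_left]
      linarith [h y hy]
    · change inner ℝ (a - b) x = v - u
      rw [inner_sub_left]
      linarith [h x hx]
  subst hab
  exact ⟨rfl, by linarith [h x hx]⟩

/-- A concave function lies below each affine function with which it agrees near a point. -/
lemma ConcaveOn.le_affine_of_eqOn {d : ℕ} {P F : Set (Rd d)} {g : Rd d → ℝ}
    (hg : ConcaveOn ℝ P g) (hFP : F ⊆ P) (hF : (interior F).Nonempty) {θ : Rd d} {ζ : ℝ}
    (h : ∀ x ∈ F, g x = inner ℝ θ x + ζ) : ∀ x ∈ P, g x ≤ inner ℝ θ x + ζ := by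
  obtain ⟨x₀, hx₀⟩ := hF
  have hlin : ConvexOn ℝ P fun x => inner ℝ θ x + ζ :=
    ((innerₛₗ ℝ θ).convexOn hg.1).add (convexOn_const ζ hg.1)
  have hconc : ConcaveOn ℝ P (g - fun x => inner ℝ θ x + ζ) := hg.sub hlin
  have hloc : IsLocalMaxOn (g - fun x => inner ℝ θ x + ζ) P x₀ := by
    refine Filter.Eventually.filter_mono nhdsWithin_le_nhds ?_
    filter_upwards [mem_interior_iff_mem_nhds.1 hx₀] with x hx
    simp [h x hx, h x₀ (interior_subset hx₀)]
  intro x hx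
  have h1 := IsMaxOn.of_isLocalMaxOn_of_concaveOn (hFP (interior_subset hx₀)) hloc hconc hx
  simp only [Set.mem_ofPred_eq, Pi.sub_apply, h x₀ (interior_subset hx₀)] at h1
  linarith

/-! ### The logarithm of a log-concave function -/

lemma nonneg_of_mem_logConcaveUSC {d : ℕ} {f : Rd d → ℝ} (hf : f ∈ LogConcaveUSC d) (x : Rd d) :
    0 ≤ f x := by
  obtain ⟨φ, -, h⟩ := hf
  rw [h]
  exact ENNReal.toReal_nonneg

lemma concaveOn_log_of_mem_logConcaveUSC {d : ℕ} {f : Rd d → ℝ} (hf : f ∈ LogConcaveUSC d)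
    (hconv : Convex ℝ (Function.support f)) :
    ConcaveOn ℝ (Function.support f) fun x => Real.log (f x) := by
  obtain ⟨φ, hφ, h⟩ := hf
  have hcoe : ∀ x ∈ Function.support f, φ x = ((Real.log (f x) : ℝ) : EReal) := by
    intro x hx
    have hx' : f x ≠ 0 := hx
    rw [h] at hx' ⊢
    induction hφx : φ x with
    | bot => simp [hφx] at hx'
    | top => exact absurd hφx (hφ.ne_top x)
    | coe r => simp [EReal.exp_coe, ENNReal.toReal_ofReal (Real.exp_pos r).le]
  refine ⟨hconv, fun x hx y hy s t hs ht hst => ?_⟩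
  obtain rfl : t = 1 - s := by linarith
  rcases hs.eq_or_lt with rfl | hs
  · simp
  rcases ht.eq_or_lt with ht | ht
  · obtain rfl : s = 1 := by linarith
    simp
  have hc := hφ.concave x y s hs (by linarith)
  rw [hcoe x hx, hcoe y hy, hcoe _ (hconv hx hy hs.le ht.le hst)] at hc
  exact_mod_cast hc

/-! ### Uniqueness of the representation -/

lemma IsLogAffineRepresentation.exists_eq {d κ κ' : ℕ} {f : Rd d → ℝ}
    {α : Fin κ → Rd d} {β : Fin κ → ℝ} {E : Fin κ → Set (Rd d)}
    {α' : Fin κ' → Rd d} {β' : Fin κ' → ℝ} {E' : Fin κ' → Set (Rd d)}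
    (h : IsLogAffineRepresentation f α β E) (h' : IsLogAffineRepresentation f α' β' E')
    {j : Fin κ'} {U : Set (Rd d)} (hU : IsOpen U) (hne : U.Nonempty) (hUE : U ⊆ E' j) :
    ∃ i, (U ∩ E i).Nonempty ∧ α' j = α i ∧ β' j = β i := by
  have hsub : U ⊆ ⋃ i, E i := by
    rw [← h.subdivision.iUnion_eq, h'.subdivision.iUnion_eq]
    exact hUE.trans (Set.subset_iUnion E' j)
  obtain ⟨i, hi⟩ :=
    exists_inter_interior_nonempty (fun i => (h.subdivision.mem i).1.isClosed) hU hne hsub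
  refine ⟨i, hi.mono (Set.inter_subset_inter_right _ interior_subset), ?_⟩
  refine eq_of_affine_eqOn (hU.inter isOpen_interior) hi fun x hx => ?_
  apply Real.exp_injective
  rw [← h.eq_exp i x (interior_subset hx.2), ← h'.eq_exp j x (hUE hx.1)]

lemma IsLogAffineRepresentation.subset_of_eq {d κ κ' : ℕ} {f : Rd d → ℝ}
    {α : Fin κ → Rd d} {β : Fin κ → ℝ} {E : Fin κ → Set (Rd d)}
    {α' : Fin κ' → Rd d} {β' : Fin κ' → ℝ} {E' : Fin κ' → Set (Rd d)}
    (h : IsLogAffineRepresentation f α β E) (h' : IsLogAffineRepresentation f α' β' E')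
    {i : Fin κ} {j : Fin κ'} (hij : α' j = α i) : E' j ⊆ E i := by
  have hcl := (h.subdivision.mem i).1.isClosed
  refine subset_of_interior_subset (h'.subdivision.mem j) hcl ?_
  by_contra hcon
  obtain ⟨x, hx, hxi⟩ := Set.not_subset.1 hcon
  obtain ⟨l, ⟨y, hy, hyl⟩, hl, -⟩ := h.exists_eq h' (isOpen_interior.sdiff hcl) ⟨x, hx, hxi⟩
    (Set.sdiff_subset.trans interior_subset)
  have : l = i := by
    by_contra hne
    exact h.distinct l i hne (hl.symm.trans hij)
  exact hy.2 (this ▸ hyl)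

lemma IsLogAffineRepresentation.unique {d κ κ' : ℕ} {f : Rd d → ℝ}
    {α : Fin κ → Rd d} {β : Fin κ → ℝ} {E : Fin κ → Set (Rd d)}
    {α' : Fin κ' → Rd d} {β' : Fin κ' → ℝ} {E' : Fin κ' → Set (Rd d)}
    (h : IsLogAffineRepresentation f α β E) (h' : IsLogAffineRepresentation f α' β' E') :
    ∃ σ : Fin κ' ≃ Fin κ, ∀ j, α' j = α (σ j) ∧ β' j = β (σ j) ∧ E' j = E (σ j) := by
  have h1 : ∀ j, ∃ i, α' j = α i ∧ β' j = β i := fun j =>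
    (h.exists_eq h' isOpen_interior (h'.subdivision.mem j).2 interior_subset).imp fun i hi => hi.2
  have h2 : ∀ i, ∃ j, α i = α' j := fun i =>
    (h'.exists_eq h isOpen_interior (h.subdivision.mem i).2 interior_subset).imp fun i hi => hi.2.1
  choose σ hσ using h1
  have hinj : Function.Injective σ := fun j l hjl => by
    by_contra hne
    exact h'.distinct j l hne (by rw [(hσ j).1, (hσ l).1, hjl])
  have hsurj : Function.Surjective σ := fun i => by
    obtain ⟨j, hj⟩ := h2 i
    refine ⟨j, ?_⟩
    by_contra hne
    exact h.distinct _ _ hne (by rw [hj, (hσ j).1])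
  refine ⟨Equiv.ofBijective σ ⟨hinj, hsurj⟩, fun j => ⟨(hσ j).1, (hσ j).2, ?_⟩⟩
  exact (h.subset_of_eq h' (hσ j).1).antisymm (h'.subset_of_eq h (hσ j).1.symm)

/-! ### Existence of the representation -/

/-- The part of `P` on which the affine function `x ↦ ⟪α j, x⟫ + β j` is the smallest of those given
by `α` and `β`. The index `i = j` is left out so that the normals `α j - α i` are non-zero. -/
def minCell {d : ℕ} {ι : Type*} (P : Set (Rd d)) (α : ι → Rd d) (β : ι → ℝ) (j : ι) :
    Set (Rd d) :=
  P ∩ ⋂ i : {i // i ≠ j}, closedHalfSpace (α j - α i) (β i - β j)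

lemma mem_minCell {d : ℕ} {ι : Type*} {P : Set (Rd d)} {α : ι → Rd d} {β : ι → ℝ} {j : ι}
    {x : Rd d} :
    x ∈ minCell P α β j ↔ x ∈ P ∧ ∀ i, inner ℝ (α j) x + β j ≤ inner ℝ (α i) x + β i := by
  refine and_congr_right fun _ => ?_
  simp only [Set.mem_iInter, closedHalfSpace, Set.mem_ofPred_eq, inner_sub_left, Subtype.forall]
  constructor
  · intro h i
    by_cases hij : i = j
    · rw [hij]
    · linarith [h i hij]
  · intro h i _
    linarith [h i]

lemma minCell_inter_eq {d : ℕ} {ι : Type*} (P : Set (Rd d)) (α : ι → Rd d) (β : ι → ℝ)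
    (i j : ι) :
    minCell P α β i ∩ minCell P α β j =
      minCell P α β i ∩ affineHyperplane (α i - α j) (β j - β i) := by
  ext x
  simp only [Set.mem_inter_iff, mem_minCell, affineHyperplane, Set.mem_ofPred_eq, inner_sub_left]
  constructor
  · rintro ⟨⟨hx, hi⟩, -, hj⟩
    exact ⟨⟨hx, hi⟩, by linarith [hi j, hj i]⟩
  · rintro ⟨⟨hx, hi⟩, he⟩
    exact ⟨⟨hx, hi⟩, hx, fun l => by linarith [hi l]⟩

lemma isFace_minCell_inter {d : ℕ} {ι : Type*} {P : Set (Rd d)} (hP : Convex ℝ P)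
    (α : ι → Rd d) (β : ι → ℝ) (i j : ι) :
    IsFace (minCell P α β i) (minCell P α β i ∩ minCell P α β j) := by
  rw [minCell_inter_eq]
  refine isFace_inter_affineHyperplane
    (hP.inter (convex_iInter fun l => convex_closedHalfSpace _ _)) fun x hx => ?_
  have := (mem_minCell.1 hx).2 j
  change inner ℝ (α i - α j) x ≤ β j - β i
  rw [inner_sub_left]
  linarith

/-- The log-affine pieces `F j` with non-empty interior, listed without repetition of the affine
function, exhibit `log f` as a minimum of at most `k` affine functions with distinct slopes, each
equal to `log f` on some set with non-empty interior. -/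
lemma exists_log_eq_min_affine {d k : ℕ} {f : Rd d → ℝ} (hf : f ∈ LogConcaveUSC d)
    (hfk : IsLogAffine k f) (hsupp : Function.support f ∈ Polyhedra d) :
    ∃ (κ : ℕ) (α : Fin κ → Rd d) (β : Fin κ → ℝ), κ ≤ k ∧ Function.Injective α ∧
      (∀ x ∈ Function.support f, ∀ j, Real.log (f x) ≤ inner ℝ (α j) x + β j) ∧
      (∀ x ∈ Function.support f, ∃ j, Real.log (f x) = inner ℝ (α j) x + β j) ∧
      ∀ j, (interior {x ∈ Function.support f |
        Real.log (f x) = inner ℝ (α j) x + β j}).Nonempty := by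
  classical
  obtain ⟨F, hFc, hFu, hF⟩ := hfk
  choose θ ζ hθ using hF
  have hg := concaveOn_log_of_mem_logConcaveUSC hf hsupp.1.convex
  have hFP : ∀ j, F j ⊆ Function.support f := fun j => hFu ▸ Set.subset_iUnion F j
  let J : Finset (Fin k) := Finset.univ.filter fun j => (interior (F j)).Nonempty
  let S : Finset (Rd d × ℝ) := J.image fun j => (θ j, ζ j)
  have hS : ∀ p : S, ∃ j, (interior (F j)).Nonempty ∧ p.1 = (θ j, ζ j) := by
    rintro ⟨p, hp⟩
    obtain ⟨j, hj, rfl⟩ := Finset.mem_image.1 hp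
    exact ⟨j, (Finset.mem_filter.1 hj).2, rfl⟩
  have hle : ∀ p : S, ∀ x ∈ Function.support f, Real.log (f x) ≤ inner ℝ p.1.1 x + p.1.2 := by
    intro p
    obtain ⟨j, hj, hp⟩ := hS p
    rw [hp]
    exact hg.le_affine_of_eqOn (hFP j) hj (hθ j)
  have hint : ∀ p : S, (interior {x ∈ Function.support f |
      Real.log (f x) = inner ℝ p.1.1 x + p.1.2}).Nonempty := by
    intro p
    obtain ⟨j, hj, hp⟩ := hS p
    rw [hp]
    exact hj.mono (interior_mono fun x hx => ⟨hFP j hx, hθ j x hx⟩)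
  have hcov : Function.support f ⊆ ⋃ j ∈ J, F j := by
    have hcl : IsClosed (⋃ j ∈ J, F j) := isClosed_biUnion_finset fun j _ => hFc j
    refine subset_of_interior_subset hsupp hcl ?_
    by_contra hcon
    obtain ⟨x, hx, hxJ⟩ := Set.not_subset.1 hcon
    obtain ⟨i, y, hy, hyi⟩ := exists_inter_interior_nonempty hFc (isOpen_interior.sdiff hcl)
      ⟨x, hx, hxJ⟩ (hFu ▸ Set.sdiff_subset.trans interior_subset)
    exact hy.2 (Set.mem_biUnion (Finset.mem_filter.2 ⟨Finset.mem_univ i, y, hyi⟩ : i ∈ J)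
      (interior_subset hyi))
  let e : Fin S.card ≃ S := S.equivFin.symm
  refine ⟨S.card, fun j => (e j).1.1, fun j => (e j).1.2, ?_, ?_, fun x hx j => hle _ x hx, ?_,
    fun j => hint _⟩
  · exact Finset.card_image_le.trans ((Finset.card_filter_le _ _).trans (by simp))
  · intro i j hij
    have hij' : (e i).1.1 = (e j).1.1 := hij
    apply e.injective
    refine Subtype.ext (Prod.ext hij' ?_)
    -- Each of two parallel affine functions touches `log f` and bounds it from above.
    obtain ⟨x, hx⟩ := hint (e i)
    obtain ⟨y, hy⟩ := hint (e j)
    obtain ⟨hx, hx'⟩ := interior_subset hx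
    obtain ⟨hy, hy'⟩ := interior_subset hy
    have h1 := hle (e j) x hx
    have h2 := hle (e i) y hy
    rw [hij'] at h2 hx'
    linarith
  · intro x hx
    obtain ⟨j, hj, hxj⟩ := Set.mem_iUnion₂.1 (hcov hx)
    refine ⟨e.symm ⟨(θ j, ζ j), Finset.mem_image_of_mem _ hj⟩, ?_⟩
    simp only [Equiv.apply_symm_apply]
    exact hθ j x hxj

theorem mainTheorem7 (d : ℕ) (hd : 1 ≤ d) (k : ℕ) (hk : 1 ≤ k) (f : Rd d → ℝ)
    (hf : f ∈ LogConcaveUSC d) (hfk : IsLogAffine k f) (hsupp : Function.support f ∈ Polyhedra d) :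
    ∃ (κ : ℕ) (α : Fin κ → Rd d) (β : Fin κ → ℝ) (E : Fin κ → Set (Rd d)),
      κ ≤ k ∧
      IsLogAffineRepresentation f α β E ∧
      (∀ (κ' : ℕ) (α' : Fin κ' → Rd d) (β' : Fin κ' → ℝ) (E' : Fin κ' → Set (Rd d)),
        IsLogAffineRepresentation f α' β' E' →
          ∃ σ : Fin κ' ≃ Fin κ, ∀ j, α' j = α (σ j) ∧ β' j = β (σ j) ∧ E' j = E (σ j)) ∧
      (∀ m : ℕ, Function.support f ∈ PolyhedraWithFacets d m →
        ∀ j, E j ∈ PolyhedraWithFacets d (k + m - 1)) := by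
  obtain ⟨κ, α, β, hκ, hα, hle, heq, hint⟩ := exists_log_eq_min_affine hf hfk hsupp
  have hmem : ∀ j, ∀ x ∈ minCell (Function.support f) α β j,
      Real.log (f x) = inner ℝ (α j) x + β j := by
    intro j x hx
    obtain ⟨hx, hj⟩ := mem_minCell.1 hx
    obtain ⟨i, hi⟩ := heq x hx
    exact le_antisymm (hle x hx j) (hi ▸ hj i)
  have hint' : ∀ j, (interior (minCell (Function.support f) α β j)).Nonempty := by
    refine fun j => (hint j).mono (interior_mono ?_)
    rintro x ⟨hx, hj⟩
    exact mem_minCell.2 ⟨hx, fun i => hj ▸ hle x hx i⟩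
  have hne : ∀ j, ∀ i : {i // i ≠ j}, α j - α i ≠ 0 := fun j i =>
    sub_ne_zero.2 fun h => i.2 (hα h).symm
  have hpoly : ∀ j, minCell (Function.support f) α β j ∈ Polyhedra d := fun j =>
    ⟨hsupp.1.inter_iInter _ _ (hne j), hint' j⟩
  have hrep : IsLogAffineRepresentation f α β (minCell (Function.support f) α β) := by
    refine ⟨⟨hpoly, ?_, ?_, ?_⟩, ?_, fun i j hij h => hij (hα h)⟩
    · intro i j hij
      refine hα (eq_of_affine_eqOn isOpen_interior (hint' i) (u := β i) (v := β j) ?_).1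
      intro x hx
      have hx := interior_subset hx
      rw [← hmem i x hx, hmem j x (hij ▸ hx)]
    · refine Set.Subset.antisymm (fun x hx => ?_) (Set.iUnion_subset fun j => Set.inter_subset_left)
      obtain ⟨j, hj⟩ := heq x hx
      exact Set.mem_iUnion.2 ⟨j, mem_minCell.2 ⟨hx, fun i => hj ▸ hle x hx i⟩⟩
    · intro i j
      refine ⟨isFace_minCell_inter hsupp.1.convex α β i j, ?_⟩
      rw [Set.inter_comm]
      exact isFace_minCell_inter hsupp.1.convex α β j i
    · intro j x hx
      have hx0 : f x ≠ 0 := (mem_minCell.1 hx).1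
      rw [← hmem j x hx,
        Real.exp_log (lt_of_le_of_ne (nonneg_of_mem_logConcaveUSC hf x) hx0.symm)]
  refine ⟨κ, α, β, minCell (Function.support f) α β, hκ, hrep,
    fun κ' α' β' E' h' => hrep.unique h', fun m hm j => ⟨hpoly j, ?_⟩⟩
  refine (encard_facets_inter_le hsupp.1 _ _ (hne j) (hint' j)).trans
    ((add_le_add_left hm.2 _).trans ?_)
  have hcard : Fintype.card {i // i ≠ j} = κ - 1 := by
    rw [Fintype.card_subtype_compl, Fintype.card_fin, Fintype.card_subtype_eq]
  rw [hcard]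
  norm_cast
  omega
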